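/- A packing sequence is an infinite non-decreasing sequence $S=(s_1,s_2,\dots)$ of positive integers. An $S$-packing $k$-coloring of a graph $G$ is a map $\phi\colon V(G)\to\{1,\dots,k\}$ such that any two distinct vertices $u,v$ with $\phi(u)=\phi(v)=i$ satisfy $d_G(u,v)>s_i$ (the distance between vertices of different components being infinite). The $S$-packing chromatic number $\chi_S(G)$ is the least $k$ for which $G$ has an $S$-packing $k$-coloring, and $G$ is $\chi_S$-vertex-critical if $\chi_S(G-v)<\chi_S(G)$ for every $v\in V(G)$. Write $\mathcal S_{a,b,c,d}$ for the set of packing sequences with $(s_1,s_2,s_3,s_4)=(a,b,c,d)$, and $\mathcal S_{a,b,\overline{c},d}$ for the set of packing sequences with $s_1=a$, $s_2=b$, $c\le s_3\le d$ and $s_4=d$. **Theorem.** Let $S$ be a packing sequence and let $C_n$ be the cycle of order $n\ge 3$. (i) If $S\in\mathcal S_{1,2,4,4}$ or $S\in\mathcal S_{1,3,4,4}$, then $C_n$ is $\chi_S$-vertex-critical if and only if $n\le 9$. (ii) If $S\in\mathcal S_{1,2,\overline{4},5}$, then $C_n$ is $\chi_S$-vertex-critical if and only if $n\le 11$ or $n=17$.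 (iii) If $S\in\mathcal S_{1,2,\overline{4},6}$, then $C_n$ is $\chi_S$-vertex-critical if and only if $n\le 13$ or $n\in\{17,18,19,20,25,26,27,33,34,41\}$. (iv) If $S\in\mathcal S_{1,3,4,5}$, then $C_n$ is $\chi_S$-vertex-critical if and only if $n\le 11$ or $n\in\{15,17,23\}$. (v) If $S\in\mathcal S_{1,3,5,5}$, then $C_n$ is $\chi_S$-vertex-critical if and only if $n\le 10$ or $n$ is odd. (vi) If $S\in\mathcal S_{1,2,\overline{4},7}\cup\mathcal S_{1,3,\overline{4},7}\cup\mathcal S_{1,3,\overline{5},6}$, then $C_n$ is $\chi_S$-vertex-critical if and only if $n\not\equiv 0\pmod 8$ or $n=8$. -/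

import Mathlib

/-- An infinite sequence `(s_1, s_2, ...)` of positive integers that is non-decreasing.
Sequences are indexed from `1`; the value at index `0` plays no role. -/
structure IsPackingSequence (s : ℕ → ℕ) : Prop where
  pos : ∀ i, 1 ≤ i → 0 < s i
  mono : ∀ i j, 1 ≤ i → i ≤ j → s i ≤ s j

/-- `S_{a,b,c,d}`: the packing sequences with `s_1 = a`, `s_2 = b`, `s_3 = c`, `s_4 = d`. -/
def packingFamily (a b c d : ℕ) : Set (ℕ → ℕ) :=
  {s | IsPackingSequence s ∧ s 1 = a ∧ s 2 = b ∧ s 3 = c ∧ s 4 = d}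

/-- The family `S` with subscript `a, b, c, d` and a bar over the third entry: the packing
sequences with `s_1 = a`, `s_2 = b`, `c ≤ s_3 ≤ d`, `s_4 = d`. -/
def packingFamilyBar (a b c d : ℕ) : Set (ℕ → ℕ) :=
  {s | IsPackingSequence s ∧ s 1 = a ∧ s 2 = b ∧ (c ≤ s 3 ∧ s 3 ≤ d) ∧ s 4 = d}

namespace SimpleGraph

variable {V : Type*}

/-- `φ` is an `S`-packing `k`-coloring of `G`: the colors are in `{1, ..., k}`, and two distinct
vertices of the same color `i` are at distance greater than `s_i`. The distance is infinite
between different components. -/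
structure IsPackingColoring (G : SimpleGraph V) (s : ℕ → ℕ) (k : ℕ) (φ : V → ℕ) : Prop where
  range : ∀ v, 1 ≤ φ v ∧ φ v ≤ k
  far : ∀ u v, u ≠ v → φ u = φ v → (s (φ u) : ℕ∞) < G.edist u v

/-- The `S`-packing chromatic number: the least `k` such that `G` has an `S`-packing
`k`-coloring (`⊤` if there is none, which cannot happen for a finite graph). -/
noncomputable def packingChromaticNumber (G : SimpleGraph V) (s : ℕ → ℕ) : ℕ∞ :=
  ⨅ k ∈ {k : ℕ | ∃ φ : V → ℕ, G.IsPackingColoring s k φ}, (k : ℕ∞)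

/-- `G` is `χ_S`-vertex-critical: deleting any vertex lowers the `S`-packing chromatic number. -/
def IsPackingVertexCritical (G : SimpleGraph V) (s : ℕ → ℕ) : Prop :=
  ∀ v : V, (G.induce {v}ᶜ).packingChromaticNumber s < G.packingChromaticNumber s

end SimpleGraph

/-! ### Words with spaced letters -/

/-! The periodic word 1 2 1 3 1 2 1 4 (`ruler`) has gaps sufficient for (1, 3, 7, 7), so four colors
suffice on every path. With gaps at least 1, 2, 4, three colors never suffice on eight consecutive
vertices. For `n ≥ 9` the graph `C_n - v` therefore needs exactly four colors, and criticality means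
that `C_n` has no 4-coloring; every `n ≤ 8` is critical (`cycleGraph_isPackingVertexCritical_iff`).

A 4-coloring of `C_n` unrolls to a periodic word, in which consecutive letters 4 lie between `s_4 +
1` and 8 apart. So `n` is a sum of such gaps (`Cyclic.exists_gap_count`), which settles nonexistence
when `s_2 = 2` or `s_4 = 7`. For `s_2 = 3` and `s_4` equal to 5 or 6, gap 7 is special: it is
impossible if `s_3 ≥ 5` (`Cyclic.not_nextFour_seven`), and for (1, 3, 4, 5) it cannot lie between
two gaps 8 (`Cyclic.not_eight_seven_eight`), which excludes 15 and 23.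

Conversely, closed words with a common `ruler` prefix can be concatenated (`Closable.add`), so
colorings arise from writing `n` as a sum of a few block lengths. -/

namespace PackingWord

/-- Among the first `m` letters of `f`, equal letters `c` are more than `t c` apart. -/
def Spaced (t f : ℕ → ℕ) (m : ℕ) : Prop :=
  ∀ j < m, ∀ i < j, f i = f j → t (f i) < j - i

instance (t f : ℕ → ℕ) (m : ℕ) : Decidable (Spaced t f m) := by
  unfold Spaced; infer_instance

/-- The function with the values `a, b, c, d` at `1, 2, 3, 4`. -/
def entries (a b c d : ℕ) : ℕ → ℕ
  | 1 => a
  | 2 => b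
  | 3 => c
  | 4 => d
  | _ => 0

/-- The periodic word `1 2 1 3 1 2 1 4 ...`. -/
def ruler (i : ℕ) : ℕ :=
  if i % 2 = 0 then 1 else if i % 4 = 1 then 2 else if i % 8 = 3 then 3 else 4

lemma ruler_mem (i : ℕ) : 1 ≤ ruler i ∧ ruler i ≤ 4 := by
  unfold ruler; split_ifs <;> omega

lemma ruler_spaced (i j : ℕ) (hij : i < j) (h : ruler i = ruler j) :
    entries 1 3 7 7 (ruler i) < j - i := by
  unfold ruler at *
  split_ifs at h ⊢ <;> simp only [entries] <;> omega

/-! ### Exhaustive search for spaced words with prescribed letter sets -/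

/-- Whether the word `h`, written with its latest letter first, extends by letters from the
successive lists so that each new letter `c` is absent from the `t c` letters before it. -/
def fillable (t : ℕ → ℕ) : List (List ℕ) → List ℕ → Bool
  | [], _ => true
  | A :: As, h => A.any fun c => !((h.take (t c)).elem c) && fillable t As (c :: h)

/-- The first `m` letters of `f`, the latest first. -/
def history (f : ℕ → ℕ) : ℕ → List ℕ
  | 0 => []
  | m + 1 => f m :: history f m

lemma mem_take_history {f : ℕ → ℕ} {c : ℕ} :
    ∀ {m k : ℕ}, c ∈ (history f m).take k → ∃ i < m, m ≤ i + k ∧ f i = c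
  | 0, k, h => by simp [history] at h
  | m + 1, 0, h => by simp at h
  | m + 1, k + 1, h => by
    rw [history, List.take_succ_cons, List.mem_cons] at h
    rcases h with rfl | h
    · exact ⟨m, by omega, by omega, rfl⟩
    · obtain ⟨i, hi, hk, hf⟩ := mem_take_history h
      exact ⟨i, by omega, by omega, hf⟩

lemma fillable_history {t f : ℕ → ℕ} :
    ∀ (As : List (List ℕ)) (m : ℕ), Spaced t f (m + As.length) →
      (∀ i (hi : i < As.length), f (m + i) ∈ As[i]) → fillable t As (history f m) = true
  | [], m, _, _ => rfl
  | A :: As, m, hs, hA => by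
    rw [fillable, List.any_eq_true]
    refine ⟨f m, hA 0 (by simp), ?_⟩
    rw [Bool.and_eq_true]
    constructor
    · rw [Bool.not_eq_true', Bool.eq_false_iff, Ne, List.elem_iff]
      intro hmem
      obtain ⟨i, hi, hk, hf⟩ := mem_take_history hmem
      have := hs m (by simp) i hi hf
      rw [hf] at this
      omega
    · refine fillable_history As (m + 1) ?_ ?_
      · rwa [List.length_cons, ← add_assoc, add_right_comm] at hs
      · intro i hi
        have := hA (i + 1) (by simpa using hi)
        rw [← add_assoc, add_right_comm] at this
        simpa using this

/-- If the search fails, no spaced word has its letters in the prescribed sets. -/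
lemma not_spaced_of_not_fillable {t f : ℕ → ℕ} (As : List (List ℕ))
    (h : fillable t As [] = false) (hA : ∀ i (hi : i < As.length), f i ∈ As[i]) :
    ¬ Spaced t f As.length := by
  intro hs
  have := fillable_history As 0 (by simpa using hs) (by simpa using hA)
  rw [history, h] at this
  exact Bool.false_ne_true this

/-! ### Periodic words and gaps between letters `4` -/

/-- `g` is a periodic word over `1, ..., k` in which equal letters `c` are more than `t c` apart. -/
structure Cyclic (t : ℕ → ℕ) (k n : ℕ) (g : ℕ → ℕ) : Prop where
  range : ∀ i, 1 ≤ g i ∧ g i ≤ k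
  periodic : ∀ i, g (i + n) = g i
  far : ∀ i j, i < j → g i = g j → t (g i) < j - i

variable {t g : ℕ → ℕ} {a k n x : ℕ}

lemma Cyclic.spaced (h : Cyclic t k n g) (x m : ℕ) : Spaced t (fun i => g (x + i)) m := by
  intro j _ i hij he
  have := h.far (x + i) (x + j) (by omega) he
  simp only
  omega

/-- A word over `1, 2, 3` with gaps `1, 2, 4` has length at most `7`. -/
lemma not_spaced_three {f : ℕ → ℕ} (h1 : 1 ≤ t 1) (h2 : 2 ≤ t 2) (h3 : 4 ≤ t 3)
    (hf : ∀ i < 8, 1 ≤ f i ∧ f i ≤ 3) : ¬ Spaced t f 8 := by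
  intro hs
  -- At most three consecutive letters avoid 3, while two letters 3 have at least four letters
  -- between them. So there is at most one 3, and the length is at most 3 + 1 + 3.
  refine not_spaced_of_not_fillable (t := entries 1 2 4 0) (f := f)
    (List.replicate 8 [1, 2, 3]) (by decide) ?_ ?_
  · intro i hi
    have := hf i (by simpa using hi)
    simp only [List.getElem_replicate, List.mem_cons, List.not_mem_nil, or_false]
    omega
  · intro j hj i hij he
    have := hs j (by simpa using hj) i hij he
    refine lt_of_le_of_lt ?_ this
    have hi := hf i (by simp at hj; omega)
    obtain h | h | h : f i = 1 ∨ f i = 2 ∨ f i = 3 := by omega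
    all_goals rw [h]; simpa [entries]

/-- The letters 1 and 2 must alternate, and among four alternating letters two letters 2 are only 2
apart. -/
lemma not_spaced_two {f : ℕ → ℕ} (h1 : 1 ≤ t 1) (h2 : 2 ≤ t 2)
    (hf : ∀ i < 4, 1 ≤ f i ∧ f i ≤ 2) : ¬ Spaced t f 4 := by
  intro hs
  refine not_spaced_of_not_fillable (t := entries 1 2 0 0) (f := f)
    (List.replicate 4 [1, 2]) (by decide) ?_ ?_
  · intro i hi
    have := hf i (by simpa using hi)
    simp only [List.getElem_replicate, List.mem_cons, List.not_mem_nil, or_false]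
    omega
  · intro j hj i hij he
    have := hs j (by simpa using hj) i hij he
    refine lt_of_le_of_lt ?_ this
    have hi := hf i (by simp at hj; omega)
    obtain h | h : f i = 1 ∨ f i = 2 := by omega
    all_goals rw [h]; simpa [entries]

/-- The next letter `4` after position `x` stands at `x + d`. -/
def NextFour (g : ℕ → ℕ) (x d : ℕ) : Prop :=
  g (x + d) = 4 ∧ 0 < d ∧ ∀ e, 0 < e → e < d → g (x + e) ≠ 4

lemma Cyclic.exists_four (h : Cyclic t 4 n g) (h1 : 1 ≤ t 1) (h2 : 2 ≤ t 2) (h3 : 4 ≤ t 3)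
    (x : ℕ) : ∃ d < 8, g (x + d) = 4 := by
  by_contra! hne
  refine not_spaced_three h1 h2 h3 (fun i hi => ?_) (h.spaced x 8)
  have := h.range (x + i)
  have := hne i hi
  omega

lemma Cyclic.exists_nextFour (h : Cyclic t 4 n g) (h1 : 1 ≤ t 1) (h2 : 2 ≤ t 2) (h3 : 4 ≤ t 3)
    (hx : g x = 4) : ∃ d, NextFour g x d ∧ t 4 < d ∧ d ≤ 8 := by
  classical
  have hex : ∃ d, g (x + 1 + d) = 4 := (h.exists_four h1 h2 h3 (x + 1)).imp fun _ hd => hd.2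
  obtain ⟨d, hd, hg⟩ := h.exists_four h1 h2 h3 (x + 1)
  have hle := Nat.find_min' hex hg
  have hspec : g (x + (Nat.find hex + 1)) = 4 := by
    rw [add_comm (Nat.find hex), ← add_assoc]; exact Nat.find_spec hex
  refine ⟨Nat.find hex + 1, ⟨hspec, by omega, ?_⟩, ?_, by omega⟩
  · intro e he hlt hge
    refine Nat.find_min hex (m := e - 1) (by omega) ?_
    rw [← hge]; congr 1; omega
  · have := h.far x _ (by omega) (hx.trans hspec.symm)
    rw [hx] at this
    omega

/-- A property that holds at `0` and is preserved by adding a gap between consecutive letters `4`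
holds for every distance between letters `4`. -/
lemma NextFour.induction {Q : ℕ → Prop} (h0 : Q 0)
    (hstep : ∀ x, g x = 4 → ∃ d, NextFour g x d ∧ ∀ m, Q m → Q (d + m)) :
    ∀ m x, g x = 4 → g (x + m) = 4 → Q m := by
  intro m
  induction m using Nat.strong_induction_on with
  | _ m ih =>
    intro x hx hm
    rcases Nat.eq_zero_or_pos m with rfl | hpos
    · exact h0
    obtain ⟨d, ⟨hd, hd0, hmin⟩, hQ⟩ := hstep x hx
    have hle : d ≤ m := not_lt.1 fun hlt => hmin m hpos hlt hm
    have := hQ (m - d) (ih (m - d) (by omega) (x + d) hd (by rw [← hm]; congr 1; omega))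
    rwa [Nat.add_sub_cancel' hle] at this

/-- A letter 4 and its copy one period later are `n` apart, so `n` is a sum of consecutive gaps. -/
lemma Cyclic.induction (h : Cyclic t 4 n g) (h1 : 1 ≤ t 1) (h2 : 2 ≤ t 2) (h3 : 4 ≤ t 3)
    {Q : ℕ → Prop} (h0 : Q 0)
    (hstep : ∀ x d, g x = 4 → NextFour g x d → t 4 < d → d ≤ 8 → ∀ m, Q m → Q (d + m)) : Q n := by
  obtain ⟨x, -, hx⟩ := h.exists_four h1 h2 h3 0
  refine NextFour.induction (g := g) h0 (fun y hy => ?_) n _ hx (by rw [h.periodic]; exact hx)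
  obtain ⟨d, hd, hlt, hle⟩ := h.exists_nextFour h1 h2 h3 hy
  exact ⟨d, hd, hstep y d hy hd hlt hle⟩

/-- The period is a sum of `k` gaps of sizes between `t 4 + 1` and `8`. -/
lemma Cyclic.exists_gap_count (h : Cyclic t 4 n g) (h1 : 1 ≤ t 1) (h2 : 2 ≤ t 2) (h3 : 4 ≤ t 3)
    (h4 : a ≤ t 4) : ∃ k, (a + 1) * k ≤ n ∧ n ≤ 8 * k := by
  refine h.induction h1 h2 h3 (Q := fun m => ∃ k, (a + 1) * k ≤ m ∧ m ≤ 8 * k) ⟨0, by simp⟩ ?_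
  rintro x d - - hlt hle m ⟨k, hk⟩
  exact ⟨k + 1, by rw [mul_add]; omega, by omega⟩

/-! ### Forbidden gap patterns -/

lemma Cyclic.not_of_not_fillable {t' : ℕ → ℕ} (h : Cyclic t 4 n g)
    (ht : ∀ c, 1 ≤ c → c ≤ 4 → t' c ≤ t c) (As : List (List ℕ))
    (hAs : fillable t' As [] = false) (y : ℕ) : ¬ ∀ i (hi : i < As.length), g (y + i) ∈ As[i] := by
  intro hA
  refine not_spaced_of_not_fillable (t := t') (f := fun i => g (y + i)) As hAs hA ?_
  intro j hj i hij he
  have hr := h.range (y + i)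
  exact (ht _ hr.1 hr.2).trans_lt (h.spaced y As.length j hj i hij he)

lemma Cyclic.mem_all (h : Cyclic t 4 n g) (y : ℕ) : g y ∈ [1, 2, 3, 4] := by
  have := h.range y
  simp only [List.mem_cons, List.not_mem_nil, or_false]
  omega

lemma Cyclic.mem_three (h : Cyclic t 4 n g) {y : ℕ} (hy : g y ≠ 4) : g y ∈ [1, 2, 3] := by
  have := h.range y
  simp only [List.mem_cons, List.not_mem_nil, or_false]
  omega

/-- Six letters over 1, 2, 3 must be 2 1 3 1 2 1 or its reverse. Next to the end 2 1 3, beyond the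
4, the first letter must be 1 and then no second letter fits. Two free letters on each side thus
suffice for the contradiction. -/
lemma Cyclic.not_nextFour_seven (h : Cyclic t 4 n g) (hn : 2 ≤ n) (h1 : 1 ≤ t 1) (h2 : 3 ≤ t 2)
    (h3 : 5 ≤ t 3) (h4 : 5 ≤ t 4) (hx : g x = 4) : ¬ NextFour g x 7 := by
  rintro ⟨h7, -, hmin⟩
  -- The window starts two letters before a 4; moving it by one period keeps its index a natural
  -- number.
  have hshift : ∀ i, g (x + n + i) = g (x + i) := fun i => by
    rw [add_right_comm, h.periodic]
  refine h.not_of_not_fillable (t' := entries 1 3 5 5) ?_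
    (List.replicate 2 [1, 2, 3, 4] ++ [4] :: (List.replicate 6 [1, 2, 3] ++
      [4] :: List.replicate 2 [1, 2, 3, 4])) (by decide) (x + n - 2) ?_
  · intro c hc hc'
    interval_cases c <;> simpa [entries]
  · intro i hi
    have key : ∀ e, g (x + n - 2 + (2 + e)) = g (x + e) := fun e => by
      rw [← hshift]; congr 1; omega
    simp only [List.length_append, List.length_replicate, List.length_cons] at hi
    have hall := h.mem_all (x + n - 2 + i)
    have hmid : ∀ e, 0 < e → e < 7 → g (x + n - 2 + (2 + e)) ∈ [1, 2, 3] := fun e he he' => by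
      rw [key]; exact h.mem_three (hmin e he he')
    interval_cases i
    · exact hall
    · exact hall
    · simpa using (key 0).trans hx
    · exact hmid 1 (by omega) (by omega)
    · exact hmid 2 (by omega) (by omega)
    · exact hmid 3 (by omega) (by omega)
    · exact hmid 4 (by omega) (by omega)
    · exact hmid 5 (by omega) (by omega)
    · exact hmid 6 (by omega) (by omega)
    · simpa using (key 7).trans h7
    · exact hall
    · exact hall

end PackingWord
namespace PackingWord

variable {t g : ℕ → ℕ} {k n x d : ℕ}

/-- Gap 7 is again filled by 2 1 3 1 2 1 or its reverse. Beyond the 4 next to the end 2 1 3, the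
letters read outward must start 1 3. Of the other five letters in that gap 8 only the farthest can
be 3, which leaves four consecutive letters over 1, 2. -/
lemma Cyclic.not_eight_seven_eight (h : Cyclic t 4 n g) (h1 : 1 ≤ t 1) (h2 : 3 ≤ t 2)
    (h3 : 4 ≤ t 3) (h4 : 5 ≤ t 4) (hx : g x = 4) (ha : NextFour g x 8)
    (hb : NextFour g (x + 8) 7) (hc : NextFour g (x + 15) 8) : False := by
  refine h.not_of_not_fillable (t' := entries 1 3 4 5) ?_
    ((List.range 24).map fun i => if i = 0 ∨ i = 8 ∨ i = 15 ∨ i = 23 then [4] else [1, 2, 3])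
    (by decide) x ?_
  · intro c hc hc'
    interval_cases c <;> simpa [entries]
  · intro i hi
    simp only [List.length_map, List.length_range] at hi
    rw [List.getElem_map, List.getElem_range]
    split_ifs with hi'
    · rw [List.mem_singleton]
      rcases hi' with rfl | rfl | rfl | rfl
      exacts [hx, ha.1, hb.1, hc.1]
    · apply h.mem_three
      obtain hlt | hlt | hlt : i < 8 ∨ (8 < i ∧ i < 15) ∨ 15 < i := by omega
      · exact ha.2.2 i (by omega) hlt
      · have := hb.2.2 (i - 8) (by omega) (by omega)
        rwa [show x + 8 + (i - 8) = x + i by omega] at this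
      · have := hc.2.2 (i - 15) (by omega) (by omega)
        rwa [show x + 15 + (i - 15) = x + i by omega] at this

lemma Cyclic.nextFour_add_period (h : Cyclic t k n g) (hx : NextFour g x d) :
    NextFour g (x + n) d := by
  have hshift : ∀ i, g (x + n + i) = g (x + i) := fun i => by
    rw [add_right_comm, h.periodic]
  exact ⟨(hshift d).trans hx.1, hx.2.1, fun e he hed => by rw [hshift]; exact hx.2.2 e he hed⟩

lemma NextFour.le {m : ℕ} (hx : NextFour g x d) (hm : 0 < m) (h : g (x + m) = 4) : d ≤ m :=
  not_lt.1 fun hlt => hx.2.2 m hm hlt h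

lemma Cyclic.not_fifteen (h : Cyclic t 4 15 g) (h1 : 1 ≤ t 1) (h2 : 3 ≤ t 2)
    (h3 : 4 ≤ t 3) (h4 : 5 ≤ t 4) : False := by
  obtain ⟨x, -, hx⟩ := h.exists_four h1 (by omega) h3 0
  generalize 0 + x = x at hx
  obtain ⟨d, hd, hd5, hd8⟩ := h.exists_nextFour h1 (by omega) h3 hx
  obtain ⟨e, he, he5, he8⟩ := h.exists_nextFour h1 (by omega) h3 hd.1
  have hn : g (x + 15) = 4 := (h.periodic x).trans hx
  have hle := he.le (m := 15 - d) (by omega) (by rwa [show x + d + (15 - d) = x + 15 by omega])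
  -- Both gaps are at least 6, so a positive remainder would be at most 3, too short for another
  -- gap.
  have hsum : d + e = 15 := by
    by_contra hne
    have := h.far (x + d + e) (x + 15) (by omega) (he.1.trans hn.symm)
    rw [he.1] at this
    omega
  have hd' := h.nextFour_add_period hd
  have he' := h.nextFour_add_period he
  -- Going around the cycle, the single gap 8 stands on both sides of the gap 7.
  obtain ⟨rfl, rfl⟩ | ⟨rfl, rfl⟩ : (d = 7 ∧ e = 8) ∨ (d = 8 ∧ e = 7) := by omega
  · exact h.not_eight_seven_eight h1 h2 h3 h4 hd.1 he hd' he'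
  · exact h.not_eight_seven_eight h1 h2 h3 h4 hx hd he hd'

lemma Cyclic.not_twentyThree (h : Cyclic t 4 23 g) (h1 : 1 ≤ t 1) (h2 : 3 ≤ t 2)
    (h3 : 4 ≤ t 3) (h4 : 5 ≤ t 4) : False := by
  obtain ⟨x, -, hx⟩ := h.exists_four h1 (by omega) h3 0
  generalize 0 + x = x at hx
  obtain ⟨d, hd, hd5, hd8⟩ := h.exists_nextFour h1 (by omega) h3 hx
  obtain ⟨e, he, he5, he8⟩ := h.exists_nextFour h1 (by omega) h3 hd.1
  obtain ⟨f, hf, hf5, hf8⟩ := h.exists_nextFour h1 (by omega) h3 he.1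
  have hn : g (x + 23) = 4 := (h.periodic x).trans hx
  have hle := hf.le (m := 23 - d - e) (by omega)
    (by rwa [show x + d + e + (23 - d - e) = x + 23 by omega])
  have hsum : d + e + f = 23 := by
    by_contra hne
    have := h.far (x + d + e + f) (x + 23) (by omega) (hf.1.trans hn.symm)
    rw [hf.1] at this
    omega
  have hd' := h.nextFour_add_period hd
  have he' := h.nextFour_add_period he
  obtain ⟨rfl, rfl, rfl⟩ | ⟨rfl, rfl, rfl⟩ | ⟨rfl, rfl, rfl⟩ :
      (d = 7 ∧ e = 8 ∧ f = 8) ∨ (d = 8 ∧ e = 7 ∧ f = 8) ∨ (d = 8 ∧ e = 8 ∧ f = 7) := by omega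
  · exact h.not_eight_seven_eight h1 h2 h3 h4 he.1 hf hd' he'
  · exact h.not_eight_seven_eight h1 h2 h3 h4 hx hd he hf
  · exact h.not_eight_seven_eight h1 h2 h3 h4 hd.1 he hf hd'

/-! ### Closed words built from blocks -/

/-- There is a closed word of length `m` over `1, 2, 3, 4` that starts with the first `L` letters
of `ruler`, and in which, when these are repeated at its end, equal letters `c` are more than
`t c` apart. -/
def Closable (t : ℕ → ℕ) (L m : ℕ) : Prop :=
  ∃ f : ℕ → ℕ, (∀ i < m + L, 1 ≤ f i ∧ f i ≤ 4) ∧ (∀ i < L, f i = ruler i ∧ f (m + i) = ruler i) ∧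
    Spaced t f (m + L)

variable {L m : ℕ}

/-- The two words overlap in their common prefix of `L` letters. Two positions that do not lie in
the same word are more than `L` apart, hence far enough for every letter. -/
lemma Closable.add (ht : ∀ c, 1 ≤ c → c ≤ 4 → t c ≤ L) (hm : Closable t L m)
    (hn : Closable t L n) : Closable t L (m + n) := by
  obtain ⟨f, hf, hfr, hfs⟩ := hm
  obtain ⟨g, hg, hgr, hgs⟩ := hn
  let w : ℕ → ℕ := fun i => if i < m then f i else g (i - m)
  have hwf : ∀ i < m + L, w i = f i := by
    intro i hi
    by_cases him : i < m
    · exact if_pos him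
    · rw [show w i = g (i - m) from if_neg him, (hgr (i - m) (by omega)).1,
        ← (hfr (i - m) (by omega)).2]
      congr 1; omega
  have hwg : ∀ i, w (m + i) = g i := fun i => by
    rw [show w (m + i) = g (m + i - m) from if_neg (by omega), Nat.add_sub_cancel_left]
  have hw : ∀ i < m + n + L, 1 ≤ w i ∧ w i ≤ 4 := by
    intro i hi
    by_cases him : i < m
    · rw [hwf i (by omega)]; exact hf i (by omega)
    · have := hwg (i - m)
      rw [show m + (i - m) = i by omega] at this
      rw [this]; exact hg _ (by omega)
  refine ⟨w, hw, fun i hi => ⟨?_, ?_⟩, ?_⟩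
  · rw [hwf i (by omega)]; exact (hfr i hi).1
  · rw [add_assoc, hwg]; exact (hgr i hi).2
  · intro j hj i hij he
    by_cases hjm : j < m + L
    · rw [hwf i (by omega), hwf j hjm] at he
      rw [hwf i (by omega)]
      exact hfs j hjm i hij he
    · by_cases him : m ≤ i
      · obtain ⟨i, rfl⟩ := Nat.exists_eq_add_of_le him
        obtain ⟨j, rfl⟩ := Nat.exists_eq_add_of_le (show m ≤ j by omega)
        rw [hwg, hwg] at he
        rw [hwg]
        have := hgs j (by omega) i (by omega) he
        omega
      · have := ht (w i) (hw i (by omega)).1 (hw i (by omega)).2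
        omega

lemma closable_zero (ht : ∀ c, 1 ≤ c → c ≤ 4 → t c ≤ entries 1 3 7 7 c) : Closable t L 0 := by
  refine ⟨ruler, fun i _ => ruler_mem i, fun i _ => ⟨rfl, by rw [zero_add]⟩, ?_⟩
  intro j _ i hij he
  exact (ht _ (ruler_mem i).1 (ruler_mem i).2).trans_lt (ruler_spaced i j hij he)

lemma Closable.mul_add (ht : ∀ c, 1 ≤ c → c ≤ 4 → t c ≤ L) (hm : Closable t L m)
    (hn : Closable t L n) : ∀ a, Closable t L (m * a + n)
  | 0 => by rwa [mul_zero, zero_add]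
  | a + 1 => by
    rw [Nat.mul_succ, add_comm (m * a), add_assoc]
    exact hm.add ht (Closable.mul_add ht hm hn a)

/-- A closed word given by the list of its letters. -/
lemma closable_of_list (w : List ℕ)
    (hr : ∀ i < w.length + L, 1 ≤ w.getD (i % w.length) 0 ∧ w.getD (i % w.length) 0 ≤ 4)
    (hp : ∀ i < L, w.getD (i % w.length) 0 = ruler i)
    (hs : Spaced t (fun i => w.getD (i % w.length) 0) (w.length + L)) : Closable t L w.length :=
  ⟨fun i => w.getD (i % w.length) 0, hr,
    fun i hi => ⟨hp i hi, by
      change w.getD ((w.length + i) % w.length) 0 = _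
      rw [Nat.add_mod_left]; exact hp i hi⟩, hs⟩

/-! ### Lengths as sums of block lengths -/

lemma closable_1344 (hn : 10 ≤ n) : Closable (entries 1 3 4 4) 4 n := by
  have ht : ∀ c, 1 ≤ c → c ≤ 4 → entries 1 3 4 4 c ≤ 4 := by decide
  have h0 : Closable (entries 1 3 4 4) 4 0 := closable_zero (by decide)
  have h5 : Closable (entries 1 3 4 4) 4 5 :=
    closable_of_list [1, 2, 1, 3, 4] (by decide) (by decide) (by decide)
  have h6 : Closable (entries 1 3 4 4) 4 6 :=
    closable_of_list [1, 2, 1, 3, 1, 4] (by decide) (by decide) (by decide)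
  have h8 : Closable (entries 1 3 4 4) 4 8 :=
    closable_of_list [1, 2, 1, 3, 1, 2, 1, 4] (by decide) (by decide) (by decide)
  obtain ⟨a, h | h | h | h | h⟩ : ∃ a, n = 5 * a + 0 ∨ n = 5 * a + 6 ∨ n = 5 * a + (6 + 6) ∨
      n = 5 * a + 8 ∨ n = 5 * a + (6 + 8) := by
    obtain h | h | h | h | h : n % 5 = 0 ∨ n % 5 = 1 ∨ n % 5 = 2 ∨ n % 5 = 3 ∨ n % 5 = 4 := by
      omega
    exacts [⟨n / 5, by omega⟩, ⟨n / 5 - 1, by omega⟩, ⟨n / 5 - 2, by omega⟩, ⟨n / 5 - 1, by omega⟩,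
      ⟨n / 5 - 2, by omega⟩]
  all_goals rw [h]; apply Closable.mul_add ht h5
  exacts [h0, h6, h6.add ht h6, h8, h6.add ht h8]

lemma closable_1255 (hn : 12 ≤ n) (hn' : n ≠ 17) : Closable (entries 1 2 5 5) 5 n := by
  have ht : ∀ c, 1 ≤ c → c ≤ 4 → entries 1 2 5 5 c ≤ 5 := by decide
  have h0 : Closable (entries 1 2 5 5) 5 0 := closable_zero (by decide)
  have h6 : Closable (entries 1 2 5 5) 5 6 :=
    closable_of_list [1, 2, 1, 3, 1, 4] (by decide) (by decide) (by decide)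
  have h7 : Closable (entries 1 2 5 5) 5 7 :=
    closable_of_list [1, 2, 1, 3, 1, 2, 4] (by decide) (by decide) (by decide)
  have h8 : Closable (entries 1 2 5 5) 5 8 :=
    closable_of_list [1, 2, 1, 3, 1, 2, 1, 4] (by decide) (by decide) (by decide)
  obtain ⟨a, b, c, h⟩ : ∃ a b c, n = 6 * a + (7 * b + (8 * c + 0)) := by
    -- Take `⌈n / 8⌉` blocks of length 6 and spread the excess over them, by 2 per block and a
    -- possible remaining 1. In this range the excess is negative only for 17.
    refine ⟨(n + 7) / 8 - (n - 6 * ((n + 7) / 8)) / 2 - (n - 6 * ((n + 7) / 8)) % 2,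
      (n - 6 * ((n + 7) / 8)) % 2, (n - 6 * ((n + 7) / 8)) / 2, ?_⟩
    omega
  rw [h]
  exact h6.mul_add ht (h7.mul_add ht (h8.mul_add ht h0 c) b) a

lemma closable_1266 (hn : 14 ≤ n)
    (hn' : n ∉ ({17, 18, 19, 20, 25, 26, 27, 33, 34, 41} : Set ℕ)) :
    Closable (entries 1 2 6 6) 6 n := by
  have ht : ∀ c, 1 ≤ c → c ≤ 4 → entries 1 2 6 6 c ≤ 6 := by decide
  have h0 : Closable (entries 1 2 6 6) 6 0 := closable_zero (by decide)
  have h7 : Closable (entries 1 2 6 6) 6 7 :=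
    closable_of_list [1, 2, 1, 3, 1, 2, 4] (by decide) (by decide) (by decide)
  have h8 : Closable (entries 1 2 6 6) 6 8 :=
    closable_of_list [1, 2, 1, 3, 1, 2, 1, 4] (by decide) (by decide) (by decide)
  simp only [Set.mem_insert_iff, Set.mem_singleton_iff] at hn'
  -- Again `⌈n / 8⌉` blocks; the excluded lengths are those below 7 times this number.
  obtain ⟨b, c, h⟩ : ∃ b c, n = 7 * b + (8 * c + 0) :=
    ⟨8 * ((n + 7) / 8) - n, n - 7 * ((n + 7) / 8), by omega⟩
  rw [h]
  exact h7.mul_add ht (h8.mul_add ht h0 c) b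

lemma exists_six_eight (h : Even n) (hn : n = 0 ∨ n = 6 ∨ n = 8 ∨ 12 ≤ n) :
    ∃ a b, n = 6 * a + (8 * b + 0) := by
  obtain ⟨m, rfl⟩ := h
  -- Solves `m = 3a + 4b`, where `b ≡ m` modulo 3.
  exact ⟨(m - 4 * (m % 3)) / 3, m % 3, by omega⟩

lemma closable_even_1355 (h : Even n) (hn : n = 0 ∨ n = 6 ∨ n = 8 ∨ 12 ≤ n) :
    Closable (entries 1 3 5 5) 5 n := by
  have ht : ∀ c, 1 ≤ c → c ≤ 4 → entries 1 3 5 5 c ≤ 5 := by decide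
  have h0 : Closable (entries 1 3 5 5) 5 0 := closable_zero (by decide)
  have h6 : Closable (entries 1 3 5 5) 5 6 :=
    closable_of_list [1, 2, 1, 3, 1, 4] (by decide) (by decide) (by decide)
  have h8 : Closable (entries 1 3 5 5) 5 8 :=
    closable_of_list [1, 2, 1, 3, 1, 2, 1, 4] (by decide) (by decide) (by decide)
  obtain ⟨a, b, rfl⟩ := exists_six_eight h hn
  exact h6.mul_add ht (h8.mul_add ht h0 b) a

lemma Closable.mono {t' : ℕ → ℕ} (h : Closable t L m) (ht : ∀ c, 1 ≤ c → c ≤ 4 → t' c ≤ t c) :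
    Closable t' L m := by
  obtain ⟨f, hf, hfr, hfs⟩ := h
  refine ⟨f, hf, hfr, fun j hj i hij he => ?_⟩
  have := hf i (by omega)
  exact (ht _ this.1 this.2).trans_lt (hfs j hj i hij he)

lemma closable_1345 (hn : 12 ≤ n) (hn' : n ∉ ({15, 17, 23} : Set ℕ)) :
    Closable (entries 1 3 4 5) 5 n := by
  have heven : ∀ m, Even m → m = 0 ∨ m = 6 ∨ m = 8 ∨ 12 ≤ m → Closable (entries 1 3 4 5) 5 m :=
    fun m h hm => (closable_even_1355 h hm).mono (by decide)
  simp only [Set.mem_insert_iff, Set.mem_singleton_iff] at hn'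
  rcases Nat.even_or_odd n with h | h
  · exact heven n h (by omega)
  -- One block with gaps 7 and 6 fixes the parity. The remainder is an even sum of 6 and 8 unless it
  -- is 2, 4 or 10, that is, unless `n` is 15, 17 or 23.
  · have h13 : Closable (entries 1 3 4 5) 5 13 :=
      closable_of_list [1, 2, 1, 3, 1, 2, 4, 1, 3, 1, 2, 1, 4] (by decide) (by decide) (by decide)
    obtain ⟨m, rfl⟩ := h
    have := h13.add (by decide) (heven (2 * m + 1 - 13) (by rw [Nat.even_iff]; omega) (by omega))
    rwa [show 13 + (2 * m + 1 - 13) = 2 * m + 1 by omega] at this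

lemma closable_1377 (h : 8 ∣ n) : Closable (entries 1 3 7 7) 7 n := by
  obtain ⟨a, rfl⟩ := h
  have h8 : Closable (entries 1 3 7 7) 7 8 :=
    closable_of_list [1, 2, 1, 3, 1, 2, 1, 4] (by decide) (by decide) (by decide)
  exact h8.mul_add (by decide) (closable_zero (by decide)) a

end PackingWord
/-! ### Packing colorings of cycles and of cycles with a vertex deleted -/

namespace SimpleGraph

open PackingWord

section Generic

variable {V : Type*} {G : SimpleGraph V} {s t : ℕ → ℕ} {k l : ℕ} {φ : V → ℕ}

lemma lt_edist_of_forall_walk {u v : V} (h : ∀ p : G.Walk u v, k < p.length) :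
    (k : ℕ∞) < G.edist u v := by
  by_cases hr : G.Reachable u v
  · obtain ⟨p, hp⟩ := hr.exists_walk_length_eq_edist
    rw [← hp]
    exact_mod_cast h p
  · rw [edist_eq_top_of_not_reachable hr]
    exact ENat.natCast_lt_top k

lemma edist_le_of_adj_succ {h : ℕ → V} {m : ℕ} (hadj : ∀ i < m, G.Adj (h i) (h (i + 1))) (i : ℕ) :
    ∀ d, i + d ≤ m → G.edist (h i) (h (i + d)) ≤ d
  | 0, _ => by simp
  | d + 1, hd => by
    refine (G.edist_triangle (v := h (i + d))).trans ?_
    rw [Nat.cast_add, Nat.cast_one]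
    exact add_le_add (edist_le_of_adj_succ hadj i d (by omega))
      (edist_le_one_iff_adj_or_eq.2 (Or.inl (hadj (i + d) (by omega))))

lemma IsPackingColoring.mono (h : G.IsPackingColoring s k φ)
    (ht : ∀ c, 1 ≤ c → c ≤ k → t c ≤ s c) : G.IsPackingColoring t k φ := by
  refine ⟨h.range, fun u v huv he => lt_of_le_of_lt ?_ (h.far u v huv he)⟩
  exact_mod_cast ht _ (h.range u).1 (h.range u).2

lemma IsPackingColoring.mono_card (h : G.IsPackingColoring s k φ) (hkl : k ≤ l) :
    G.IsPackingColoring s l φ :=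
  ⟨fun v => ⟨(h.range v).1, (h.range v).2.trans hkl⟩, h.far⟩

lemma packingChromaticNumber_le (h : G.IsPackingColoring s k φ) :
    G.packingChromaticNumber s ≤ k :=
  iInf₂_le k ⟨φ, h⟩

lemma add_one_le_packingChromaticNumber (h : ¬ ∃ φ, G.IsPackingColoring s k φ) :
    ((k + 1 : ℕ) : ℕ∞) ≤ G.packingChromaticNumber s := by
  refine le_iInf₂ fun l hl => ?_
  obtain ⟨ψ, hψ⟩ := hl
  rw [Nat.cast_le]
  by_contra! hlt
  exact h ⟨ψ, hψ.mono_card (by omega)⟩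

end Generic

/-! ### Translation between colorings and words -/

variable {n k : ℕ} {s : ℕ → ℕ}

lemma cycleGraph_adj_iff_val (hn : 2 ≤ n) {u v : Fin n} :
    (cycleGraph n).Adj u v ↔ (u : ℕ) + 1 = v ∨ (v : ℕ) + 1 = u ∨
      ((u : ℕ) = 0 ∧ (v : ℕ) + 1 = n) ∨ ((v : ℕ) = 0 ∧ (u : ℕ) + 1 = n) := by
  have hsub : ∀ a b : Fin n, ((a - b : Fin n) : ℕ) =
      if (b : ℕ) ≤ a then (a : ℕ) - b else n + a - b := by
    intro a b
    have ha := a.isLt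
    have hb := b.isLt
    rw [Fin.sub_def]
    simp only
    split_ifs with h
    · rw [show n - (b : ℕ) + a = (a - b) + n by omega, Nat.add_mod_right, Nat.mod_eq_of_lt]
      omega
    · rw [Nat.mod_eq_of_lt] <;> omega
  have hu := u.isLt
  have hv := v.isLt
  rw [cycleGraph_adj', hsub, hsub]
  split_ifs <;> omega

lemma mod_add_one_cases (hn : 2 ≤ n) (i : ℕ) :
    (i + 1) % n = i % n + 1 ∨ ((i + 1) % n = 0 ∧ i % n + 1 = n) := by
  have hlt := Nat.mod_lt i (show 0 < n by omega)
  rw [Nat.add_mod, Nat.mod_eq_of_lt (show 1 < n by omega)]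
  rcases Nat.lt_or_ge (i % n + 1) n with h | h
  · exact Or.inl (Nat.mod_eq_of_lt h)
  · have h' : i % n + 1 = n := by omega
    exact Or.inr ⟨by rw [h', Nat.mod_self], h'⟩

lemma cycleGraph_adj_mod (hn : 2 ≤ n) (i : ℕ) :
    (cycleGraph n).Adj ⟨i % n, Nat.mod_lt _ (by omega)⟩ ⟨(i + 1) % n, Nat.mod_lt _ (by omega)⟩ := by
  rw [cycleGraph_adj_iff_val hn]
  have := mod_add_one_cases hn i
  simp only
  omega

lemma mod_ne_mod {i j : ℕ} (hij : i < j) (hji : j - i < n) : i % n ≠ j % n := by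
  intro h
  have := Nat.le_of_dvd (by omega) ((Nat.modEq_iff_dvd' hij.le).1 h)
  omega

/-- The bound `s c < n` is needed because unrolling repeats each vertex at distance `n`. -/
lemma exists_cyclic_of_coloring (hn : 2 ≤ n) {φ : Fin n → ℕ}
    (h : (cycleGraph n).IsPackingColoring s k φ) (hs : ∀ c, 1 ≤ c → c ≤ k → s c < n) :
    ∃ g, Cyclic s k n g := by
  let w : ℕ → Fin n := fun i => ⟨i % n, Nat.mod_lt _ (by omega)⟩
  refine ⟨fun i => φ (w i), fun i => h.range _, fun i => ?_, fun i j hij he => ?_⟩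
  · simp only [w, Nat.add_mod_right]
  · have hr := h.range (w i)
    have hlt := hs _ hr.1 hr.2
    by_cases hji : j - i < n
    · have hne : w i ≠ w j := fun e => mod_ne_mod hij hji (Fin.ext_iff.1 e)
      have hle : (cycleGraph n).edist (w i) (w (i + (j - i))) ≤ (j - i : ℕ) :=
        edist_le_of_adj_succ (m := j) (fun i _ => cycleGraph_adj_mod hn i) i (j - i) (by omega)
      rw [Nat.add_sub_cancel' hij.le] at hle
      exact_mod_cast (h.far _ _ hne he).trans_le hle
    · omega

lemma cycleGraph_walk_length (hn : 2 ≤ n) {u v : Fin n} (p : (cycleGraph n).Walk u v) :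
    ((u : ℕ) ≤ v + p.length ∧ (v : ℕ) ≤ u + p.length) ∨
      n + u ≤ v + p.length ∨ n + v ≤ u + p.length := by
  induction p with
  | nil => left; simp
  | cons hadj p ih =>
    rw [cycleGraph_adj_iff_val hn] at hadj
    rw [Walk.length_cons]
    omega

lemma exists_coloring_of_closable {L : ℕ} (hn : 3 ≤ n) (ht : ∀ c, 1 ≤ c → c ≤ 4 → s c ≤ L)
    (h : Closable s L n) : ∃ φ, (cycleGraph n).IsPackingColoring s 4 φ := by
  obtain ⟨f, hf, hfr, hfs⟩ := h
  refine ⟨fun v => f v, fun v => hf v (by omega), ?_⟩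
  have key : ∀ u v : Fin n, u < v → f u = f v →
      s (f u) < (v : ℕ) - u ∧ s (f u) + v < n + u := by
    intro u v huv he
    have hlt : (u : ℕ) < v := huv
    refine ⟨hfs v (by omega) u hlt he, ?_⟩
    have hr := hf u (by omega)
    have hL := ht _ hr.1 hr.2
    -- If the way around were too short, `u` would lie among the first `L` letters, and its copy at
    -- `n + u` would be too close to `v`.
    by_contra! hle
    have hu : f (n + u) = f u := by
      rw [(hfr u (by omega)).1, (hfr u (by omega)).2]
    have := hfs (n + u) (by omega) v (by omega) (by rw [hu, he])
    rw [← he] at this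
    omega
  intro u v huv he
  refine lt_edist_of_forall_walk fun p => ?_
  have hp := cycleGraph_walk_length (by omega) p
  have hu := u.isLt
  have hv := v.isLt
  rcases lt_or_gt_of_ne huv with hlt | hlt
  · have := key u v hlt he
    omega
  · have := key v u hlt he.symm
    rw [he]
    omega

lemma exists_spaced_of_induce_coloring (hn : 2 ≤ n) {v : Fin n} {φ : ({v}ᶜ : Set (Fin n)) → ℕ}
    (h : ((cycleGraph n).induce {v}ᶜ).IsPackingColoring s k φ) :
    ∃ f, (∀ i < n - 1, 1 ≤ f i ∧ f i ≤ k) ∧ Spaced s f (n - 1) := by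
  -- The remaining path is `v + 1, …, v + n - 1`; the minimum keeps the enumeration away from `v`
  -- for all `i`.
  have hmem : ∀ i, (⟨(v + 1 + min i (n - 2)) % n, Nat.mod_lt _ (by omega)⟩ : Fin n) ∈
      ({v}ᶜ : Set (Fin n)) := by
    intro i hi
    have hi := congrArg Fin.val (Set.mem_singleton_iff.1 hi)
    refine mod_ne_mod (n := n) (i := v) (j := v + 1 + min i (n - 2)) (by omega) (by omega) ?_
    rw [Nat.mod_eq_of_lt v.isLt]
    exact hi.symm
  let w : ℕ → ({v}ᶜ : Set (Fin n)) := fun i => ⟨_, hmem i⟩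
  refine ⟨fun i => φ (w i), fun i _ => h.range _, fun j hj i hij he => ?_⟩
  have hne : w i ≠ w j := by
    intro e
    have e := congrArg (fun x : ({v}ᶜ : Set (Fin n)) => ((x : Fin n) : ℕ)) e
    exact mod_ne_mod (n := n) (by omega) (by omega) e
  have hle : ((cycleGraph n).induce {v}ᶜ).edist (w i) (w (i + (j - i))) ≤ (j - i : ℕ) := by
    refine edist_le_of_adj_succ (m := n - 2) (fun i hi => ?_) i (j - i) (by omega)
    rw [comap_adj]
    have := cycleGraph_adj_mod hn (v + 1 + i)
    simp only [w, Function.Embedding.subtype_apply]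
    rwa [min_eq_left hi.le, min_eq_left (show i + 1 ≤ n - 2 by omega)]
  rw [Nat.add_sub_cancel' hij.le] at hle
  exact_mod_cast (h.far _ _ hne he).trans_le hle

lemma exists_induce_coloring_of_spaced (hn : 2 ≤ n) (v : Fin n) {f : ℕ → ℕ}
    (hf : ∀ i < n - 1, 1 ≤ f i ∧ f i ≤ k) (hs : Spaced s f (n - 1)) :
    ∃ φ, ((cycleGraph n).induce {v}ᶜ).IsPackingColoring s k φ := by
  -- Position along the path that starts just after `v`; every edge changes it by at most 1.
  let pos : ({v}ᶜ : Set (Fin n)) → ℕ := fun u =>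
    if (v : ℕ) < (u : Fin n) then ((u : Fin n) : ℕ) - v - 1 else (u : Fin n) + n - v - 1
  have hval : ∀ u : ({v}ᶜ : Set (Fin n)), ((u : Fin n) : ℕ) ≠ v := fun u e =>
    u.2 (Fin.ext e)
  have hlt : ∀ u, pos u < n - 1 := by
    intro u
    have := hval u
    have := (u : Fin n).isLt
    have := v.isLt
    simp only [pos]
    split_ifs <;> omega
  have hinj : ∀ u u', pos u = pos u' → u = u' := by
    intro u u' he
    have := (u : Fin n).isLt
    have := (u' : Fin n).isLt
    have := v.isLt
    refine Subtype.ext (Fin.ext ?_)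
    simp only [pos] at he
    split_ifs at he <;> omega
  have hwalk : ∀ {u u'} (p : ((cycleGraph n).induce {v}ᶜ).Walk u u'),
      pos u ≤ pos u' + p.length ∧ pos u' ≤ pos u + p.length := by
    intro u u' p
    induction p with
    | nil => simp
    | @cons a b c hadj p ih =>
      rw [comap_adj, cycleGraph_adj_iff_val hn] at hadj
      simp only [Function.Embedding.subtype_apply] at hadj
      rw [Walk.length_cons]
      have h1 := hval a
      have h2 := hval b
      have h3 := v.isLt
      have hstep : pos a ≤ pos b + 1 ∧ pos b ≤ pos a + 1 := by
        simp only [pos]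
        split_ifs <;> omega
      omega
  refine ⟨fun u => f (pos u), fun u => hf _ (hlt u), fun u u' hne he => ?_⟩
  refine lt_edist_of_forall_walk fun p => ?_
  have hp := hwalk p
  rcases lt_or_gt_of_ne fun e => hne (hinj u u' e) with h | h
  · have := hs _ (hlt u') _ h he
    omega
  · have := hs _ (hlt u) _ h he.symm
    rw [he]
    omega

/-- When `ruler` colors all paths and three colors never suffice for eight consecutive vertices, a
cycle is critical if and only if it has at most eight vertices or no coloring with four colors. -/
lemma cycleGraph_isPackingVertexCritical_iff (hn : 3 ≤ n) (h1 : s 1 = 1) (h2 : 2 ≤ s 2)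
    (h2' : s 2 ≤ 3) (h3 : 4 ≤ s 3) (h3' : s 3 ≤ 7) (h4 : s 4 ≤ 7) :
    (cycleGraph n).IsPackingVertexCritical s ↔
      n ≤ 8 ∨ ¬ ∃ φ, (cycleGraph n).IsPackingColoring s 4 φ := by
  have hle : ∀ c, 1 ≤ c → c ≤ 4 → s c ≤ entries 1 3 7 7 c := by
    intro c hc hc'
    interval_cases c <;> simp only [entries] <;> omega
  have hruler : ∀ m, Spaced s ruler m := fun m j _ i hij he =>
    (hle _ (ruler_mem i).1 (ruler_mem i).2).trans_lt (ruler_spaced i j hij he)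
  have lower : ∀ k, (∀ i < n - 1, ruler i ≤ k) →
      (¬ ∃ φ, (cycleGraph n).IsPackingColoring s k φ) →
      (cycleGraph n).IsPackingVertexCritical s := by
    intro k hk hnot v
    obtain ⟨φ, hφ⟩ := exists_induce_coloring_of_spaced (by omega) v
      (fun i hi => ⟨(ruler_mem i).1, hk i hi⟩) (hruler _)
    refine (packingChromaticNumber_le hφ).trans_lt (lt_of_lt_of_le ?_
      (add_one_le_packingChromaticNumber hnot))
    exact_mod_cast Nat.lt_succ_self k
  constructor
  · intro hcrit
    by_contra! hcon
    obtain ⟨h8, φ, hφ⟩ := hcon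
    let v : Fin n := ⟨0, by omega⟩
    refine absurd (hcrit v) (not_lt.2 ((packingChromaticNumber_le hφ).trans
      (add_one_le_packingChromaticNumber (k := 3) ?_)))
    rintro ⟨ψ, hψ⟩
    obtain ⟨f, hf, hs⟩ := exists_spaced_of_induce_coloring (by omega) hψ
    exact not_spaced_three h1.ge h2 h3 (fun i hi => hf i (by omega))
      fun j hj i hij he => hs j (by omega) i hij he
  · rintro (h8 | hnot)
    · by_cases hn4 : n ≤ 4
      · refine lower 2 (fun i hi => ?_) ?_
        · have : i < 3 := by omega
          interval_cases i <;> decide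
        · rintro ⟨φ, hφ⟩
          -- The gaps are lowered because `s 2` may be 3 while `n = 3`, and unrolling needs gaps
          -- below `n`.
          obtain ⟨g, hg⟩ := exists_cyclic_of_coloring (s := entries 1 2 0 0) (by omega)
            (hφ.mono fun c hc hc' => by interval_cases c <;> simp only [entries] <;> omega)
            fun c hc hc' => by interval_cases c <;> simp only [entries] <;> omega
          exact not_spaced_two le_rfl le_rfl (fun i _ => hg.range (0 + i)) (hg.spaced 0 4)
      · refine lower 3 (fun i hi => ?_) ?_
        · have : i < 7 := by omega
          interval_cases i <;> decide
        · rintro ⟨φ, hφ⟩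
          obtain ⟨g, hg⟩ := exists_cyclic_of_coloring (s := entries 1 2 4 0) (by omega)
            (hφ.mono fun c hc hc' => by interval_cases c <;> simp only [entries] <;> omega)
            fun c hc hc' => by interval_cases c <;> simp only [entries] <;> omega
          exact not_spaced_three le_rfl le_rfl le_rfl (fun i _ => hg.range (0 + i)) (hg.spaced 0 8)
    · exact lower 4 (fun i _ => (ruler_mem i).2) hnot

lemma exists_coloring_of_closable_of_le {a b c d L : ℕ} (hn : 3 ≤ n)
    (ht : ∀ i, 1 ≤ i → i ≤ 4 → entries a b c d i ≤ L) (h : Closable (entries a b c d) L n)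
    (h1 : s 1 ≤ a) (h2 : s 2 ≤ b) (h3 : s 3 ≤ c) (h4 : s 4 ≤ d) :
    ∃ φ, (cycleGraph n).IsPackingColoring s 4 φ := by
  obtain ⟨φ, hφ⟩ := exists_coloring_of_closable hn ht h
  exact ⟨φ, hφ.mono fun i hi hi' => by interval_cases i <;> assumption⟩

lemma exists_cyclic_of_coloring_of_le {a b c d : ℕ} (hn : 9 ≤ n)
    (hle : ∀ i, 1 ≤ i → i ≤ 4 → entries a b c d i ≤ 8)
    (h : ∃ φ, (cycleGraph n).IsPackingColoring s 4 φ)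
    (h1 : a ≤ s 1) (h2 : b ≤ s 2) (h3 : c ≤ s 3) (h4 : d ≤ s 4) :
    ∃ g, Cyclic (entries a b c d) 4 n g := by
  obtain ⟨φ, hφ⟩ := h
  exact exists_cyclic_of_coloring (by omega)
    (hφ.mono fun i hi hi' => by interval_cases i <;> assumption)
    fun i hi hi' => (hle i hi hi').trans_lt (by omega)

end SimpleGraph
-- The six families
open SimpleGraph PackingWord in
theorem theorem5p1 (s : ℕ → ℕ) (n : ℕ) (hn : 3 ≤ n) :
    (s ∈ packingFamily 1 2 4 4 ∪ packingFamily 1 3 4 4 →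
      ((SimpleGraph.cycleGraph n).IsPackingVertexCritical s ↔ n ≤ 9)) ∧
    (s ∈ packingFamilyBar 1 2 4 5 →
      ((SimpleGraph.cycleGraph n).IsPackingVertexCritical s ↔ n ≤ 11 ∨ n = 17)) ∧
    (s ∈ packingFamilyBar 1 2 4 6 →
      ((SimpleGraph.cycleGraph n).IsPackingVertexCritical s ↔
        n ≤ 13 ∨ n ∈ ({17, 18, 19, 20, 25, 26, 27, 33, 34, 41} : Set ℕ))) ∧
    (s ∈ packingFamily 1 3 4 5 →
      ((SimpleGraph.cycleGraph n).IsPackingVertexCritical s ↔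
        n ≤ 11 ∨ n ∈ ({15, 17, 23} : Set ℕ))) ∧
    (s ∈ packingFamily 1 3 5 5 →
      ((SimpleGraph.cycleGraph n).IsPackingVertexCritical s ↔ n ≤ 10 ∨ Odd n)) ∧
    (s ∈ packingFamilyBar 1 2 4 7 ∪ packingFamilyBar 1 3 4 7 ∪ packingFamilyBar 1 3 5 6 →
      ((SimpleGraph.cycleGraph n).IsPackingVertexCritical s ↔ ¬ n ≡ 0 [MOD 8] ∨ n = 8)) := by
  have main : ∀ {P : Prop}, 2 ≤ s 2 → s 2 ≤ 3 → 4 ≤ s 3 → s 3 ≤ s 4 → s 4 ≤ 7 → s 1 = 1 →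
      (n ≤ 8 → P) → (9 ≤ n → ¬ P → ∃ φ, (cycleGraph n).IsPackingColoring s 4 φ) →
      (9 ≤ n → P → ¬ ∃ φ, (cycleGraph n).IsPackingColoring s 4 φ) →
      ((cycleGraph n).IsPackingVertexCritical s ↔ P) := by
    intro P h2 h2' h3 h3' h4 h1 hsmall hpos hneg
    rw [cycleGraph_isPackingVertexCritical_iff hn h1 h2 h2' h3 (h3'.trans h4) h4]
    by_cases h8 : n ≤ 8
    · exact iff_of_true (Or.inl h8) (hsmall h8)
    · have h9 : 9 ≤ n := by omega
      refine ⟨fun h => ?_, fun h => Or.inr (hneg h9 h)⟩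
      by_contra hP
      exact h.elim h8 fun hno => hno (hpos h9 hP)
  refine ⟨?_, ?_, ?_, ?_, ?_, ?_⟩
  · intro hs
    obtain ⟨h1, h2, h2', h3, h4⟩ : s 1 = 1 ∧ 2 ≤ s 2 ∧ s 2 ≤ 3 ∧ s 3 = 4 ∧ s 4 = 4 := by
      rcases hs with ⟨-, h1, h2, h3, h4⟩ | ⟨-, h1, h2, h3, h4⟩ <;> omega
    refine main h2 h2' (by omega) (by omega) (by omega) h1 (by omega)
      (fun _ hP => exists_coloring_of_closable_of_le hn (by decide)
        (closable_1344 (by omega)) h1.le h2' h3.le h4.le) fun h9 hP hφ => ?_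
    obtain ⟨g, hg⟩ := exists_cyclic_of_coloring_of_le h9 (by decide) hφ h1.ge h2 h3.ge h4.ge
    obtain ⟨k, hk⟩ := hg.exists_gap_count (a := 4) le_rfl le_rfl le_rfl le_rfl
    omega
  · rintro ⟨-, h1, h2, ⟨h3, h3'⟩, h4⟩
    -- Existence is shown for the largest allowed `s 3`, nonexistence for the smallest.
    refine main h2.ge (by omega) (by omega) (by omega) (by omega) h1 (by omega)
      (fun _ hP => exists_coloring_of_closable_of_le hn (by decide)
        (closable_1255 (by omega) (by omega)) h1.le h2.le h3' h4.le) fun h9 hP hφ => ?_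
    obtain ⟨g, hg⟩ := exists_cyclic_of_coloring_of_le h9 (by decide) hφ h1.ge h2.ge h3 h4.ge
    obtain ⟨k, hk⟩ := hg.exists_gap_count (a := 5) le_rfl le_rfl le_rfl le_rfl
    omega
  · rintro ⟨-, h1, h2, ⟨h3, h3'⟩, h4⟩
    refine main h2.ge (by omega) (by omega) (by omega) (by omega) h1 (by omega)
      (fun _ hP => exists_coloring_of_closable_of_le hn (by decide)
        (closable_1266 (by omega) fun h => hP (Or.inr h)) h1.le h2.le h3' h4.le) fun h9 hP hφ => ?_
    obtain ⟨g, hg⟩ := exists_cyclic_of_coloring_of_le h9 (by decide) hφ h1.ge h2.ge h3 h4.ge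
    obtain ⟨k, hk⟩ := hg.exists_gap_count (a := 6) le_rfl le_rfl le_rfl le_rfl
    simp only [Set.mem_insert_iff, Set.mem_singleton_iff] at hP
    omega
  · rintro ⟨-, h1, h2, h3, h4⟩
    refine main (by omega) h2.le (by omega) (by omega) (by omega) h1 (by omega)
      (fun _ hP => exists_coloring_of_closable_of_le hn (by decide)
        (closable_1345 (by omega) fun h => hP (Or.inr h)) h1.le h2.le h3.le h4.le)
      fun h9 hP hφ => ?_
    obtain ⟨g, hg⟩ := exists_cyclic_of_coloring_of_le h9 (by decide) hφ h1.ge h2.ge h3.ge h4.ge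
    obtain ⟨k, hk⟩ := hg.exists_gap_count (a := 5) le_rfl (by decide) le_rfl le_rfl
    simp only [Set.mem_insert_iff, Set.mem_singleton_iff] at hP
    obtain rfl | rfl : n = 15 ∨ n = 23 := by omega
    · exact hg.not_fifteen le_rfl le_rfl le_rfl le_rfl
    · exact hg.not_twentyThree le_rfl le_rfl le_rfl le_rfl
  · rintro ⟨-, h1, h2, h3, h4⟩
    refine main (by omega) h2.le (by omega) (by omega) (by omega) h1 (by omega)
      (fun _ hP => exists_coloring_of_closable_of_le hn (by decide)
        (closable_even_1355 (by rw [← Nat.not_odd_iff_even]; tauto) ?_) h1.le h2.le h3.le h4.le)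
      fun h9 hP hφ => ?_
    · rw [not_or, Nat.not_odd_iff_even, Nat.even_iff] at hP
      omega
    obtain ⟨g, hg⟩ := exists_cyclic_of_coloring_of_le h9 (by decide) hφ h1.ge h2.ge h3.ge h4.ge
    obtain ⟨k, hk⟩ := hg.exists_gap_count (a := 5) le_rfl (by decide) (by decide) le_rfl
    have heven : Even n := by
      refine hg.induction le_rfl (by decide) (by decide) Even.zero ?_
      intro x d hx hd hlt hle m hm
      have hne : d ≠ 7 := by
        rintro rfl
        exact hg.not_nextFour_seven (by omega) le_rfl le_rfl le_rfl le_rfl hx hd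
      have hlt : 5 < d := hlt
      rw [Nat.even_iff] at hm ⊢
      omega
    rcases hP with hP | hP
    · omega
    · exact Nat.not_odd_iff_even.2 heven hP
  · intro hs
    obtain ⟨h1, h2, h2', h3, h34, h4⟩ : s 1 = 1 ∧ 2 ≤ s 2 ∧ s 2 ≤ 3 ∧ 4 ≤ s 3 ∧ s 3 ≤ s 4 ∧
        (s 4 = 7 ∨ s 2 = 3 ∧ 5 ≤ s 3 ∧ s 4 = 6) := by
      rcases hs with (⟨-, h1, h2, h3, h4⟩ | ⟨-, h1, h2, h3, h4⟩) | ⟨-, h1, h2, h3, h4⟩ <;> omega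
    have hmod : n ≡ 0 [MOD 8] ↔ 8 ∣ n := Nat.modEq_zero_iff_dvd
    rw [hmod]
    refine main h2 h2' h3 h34 (by omega) h1 (by omega)
      (fun _ hP => exists_coloring_of_closable_of_le hn (by decide)
        (closable_1377 (by tauto)) h1.le h2' (by omega) (by omega)) fun h9 hP hφ => ?_
    rcases h4 with h4 | ⟨h2, h3, h4⟩
    · obtain ⟨g, hg⟩ := exists_cyclic_of_coloring_of_le h9 (by decide) hφ h1.ge h2 h3 h4.ge
      obtain ⟨k, hk⟩ := hg.exists_gap_count (a := 7) le_rfl le_rfl le_rfl le_rfl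
      omega
    · obtain ⟨g, hg⟩ := exists_cyclic_of_coloring_of_le h9 (by decide) hφ h1.ge h2.ge h3 h4.ge
      have hdvd : 8 ∣ n := by
        refine hg.induction le_rfl (by decide) (by decide) (dvd_zero 8) ?_
        intro x d hx hd hlt hle m hm
        have hne : d ≠ 7 := by
          rintro rfl
          exact hg.not_nextFour_seven (by omega) le_rfl le_rfl le_rfl (by decide) hx hd
        -- Only gap 8 remains once 7 is excluded.
        have hlt : 6 < d := hlt
        omega
      omega
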